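/- Let $n\ge 0$ be an integer. The flat virtual braid group $FVB_n$ is the group with generators $s_i,\rho_i$ ($1\le i\le n-1$) and relations $s_i^2=\rho_i^2=1$ for $1\le i\le n-1$; $s_is_j=s_js_i$, $\rho_i\rho_j=\rho_j\rho_i$, $s_i\rho_j=\rho_js_i$ for $|i-j|\ge 2$; and $s_is_{i+1}s_i=s_{i+1}s_is_{i+1}$, $\rho_i\rho_{i+1}\rho_i=\rho_{i+1}\rho_i\rho_{i+1}$, $\rho_i\rho_{i+1}s_i=s_{i+1}\rho_i\rho_{i+1}$ for $1\le i\le n-2$. Let $FH_n$ be the kernel of the homomorphism $\mu:FVB_n\to S_n$ given by $\mu(s_i)=1$, $\mu(\rho_i)=(i,i+1)$. Then: (a) $FVB_n=FH_n\rtimes S_n$, where $\mu$ is the projection to $S_n$ and $S_n$ is embedded in $FVB_n$ by $(i,i+1)\mapsto\rho_i$; (b) $FH_n$ is a finitely generated Coxeter group; (c) $FVB_n$ is linear, that is, there are a field $K$, an integer $m\ge 0$ and an injective homomorphism $FVB_n\to GL_m(K)$. -/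

import Mathlib

/-- The generators `σ_i`, `ρ_i` of the virtual braid group on `n` strands. The index `i : Fin (n - 1)`
counts from `0`, so `i` stands for the pair of neighbouring strands with numbers `i` and `i + 1`
in `Fin n`. -/
inductive VBGen (n : ℕ) : Type
  | sigma (i : Fin (n - 1)) : VBGen n
  | rho (i : Fin (n - 1)) : VBGen n

namespace VBGen

/-- The letter `σ_i` of the free group on the generators. -/
def s {n : ℕ} (i : Fin (n - 1)) : FreeGroup (VBGen n) := FreeGroup.of (VBGen.sigma i)

/-- The letter `ρ_i` of the free group on the generators. -/
def r {n : ℕ} (i : Fin (n - 1)) : FreeGroup (VBGen n) := FreeGroup.of (VBGen.rho i)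

/-- `|i - j| ≥ 2`. -/
def Far {n : ℕ} (i j : Fin (n - 1)) : Prop := i.val + 2 ≤ j.val ∨ j.val + 2 ≤ i.val

/-- `j = i + 1`. -/
def Next {n : ℕ} (i j : Fin (n - 1)) : Prop := j.val = i.val + 1

end VBGen

open VBGen in
/-- The defining relators of the virtual braid group `VB_n`; the relation `u = v` is written as the
relator `u * v⁻¹`. -/
inductive VBRel (n : ℕ) : FreeGroup (VBGen n) → Prop
  | sigma_braid (i j : Fin (n - 1)) (h : Next i j) :
      VBRel n ((s i * s j * s i) * (s j * s i * s j)⁻¹)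
  | sigma_comm (i j : Fin (n - 1)) (h : Far i j) :
      VBRel n ((s i * s j) * (s j * s i)⁻¹)
  | rho_braid (i j : Fin (n - 1)) (h : Next i j) :
      VBRel n ((r i * r j * r i) * (r j * r i * r j)⁻¹)
  | rho_comm (i j : Fin (n - 1)) (h : Far i j) :
      VBRel n ((r i * r j) * (r j * r i)⁻¹)
  | rho_sq (i : Fin (n - 1)) :
      VBRel n (r i ^ 2)
  | mixed_comm (i j : Fin (n - 1)) (h : Far i j) :
      VBRel n ((s i * r j) * (r j * s i)⁻¹)
  | mixed_braid (i j : Fin (n - 1)) (h : Next i j) :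
      VBRel n ((r i * r j * s i) * (s j * r i * r j)⁻¹)

/-- The defining relators of the flat virtual braid group: those of `VB_n` together with
`σ_i ^ 2`. -/
def flatVirtualBraidRels (n : ℕ) : Set (FreeGroup (VBGen n)) :=
  {w | VBRel n w} ∪ Set.range fun i : Fin (n - 1) => VBGen.s i ^ 2

/-- The flat virtual braid group `FVB_n`. -/
abbrev FVB (n : ℕ) : Type := PresentedGroup (flatVirtualBraidRels n)

namespace FVB

/-- The generator `s_i` of `FVB_n`, the image of `σ_i`. -/
def s {n : ℕ} (i : Fin (n - 1)) : FVB n := PresentedGroup.of (VBGen.sigma i)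

/-- The generator `ρ_i` of `FVB_n`. -/
def r {n : ℕ} (i : Fin (n - 1)) : FVB n := PresentedGroup.of (VBGen.rho i)

/-- The transposition of the neighbouring points `i` and `i + 1` of `Fin n`. -/
def adjSwap {n : ℕ} (i : Fin (n - 1)) : Equiv.Perm (Fin n) :=
  Equiv.swap ⟨i.val, by omega⟩ ⟨i.val + 1, by omega⟩

theorem adjSwap_braid {n : ℕ} (i j : Fin (n - 1)) (h : VBGen.Next i j) :
    adjSwap i * adjSwap j * adjSwap i = adjSwap j * adjSwap i * adjSwap j := by
  obtain ⟨i, hi⟩ := i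
  obtain ⟨j, hj⟩ := j
  simp only [VBGen.Next] at h
  subst h
  ext x
  simp only [adjSwap, Equiv.Perm.mul_apply, Equiv.swap_apply_def, Fin.ext_iff]
  grind

theorem adjSwap_comm {n : ℕ} (i j : Fin (n - 1)) (h : VBGen.Far i j) :
    adjSwap i * adjSwap j = adjSwap j * adjSwap i := by
  obtain ⟨i, hi⟩ := i
  obtain ⟨j, hj⟩ := j
  simp only [VBGen.Far] at h
  ext x
  simp only [adjSwap, Equiv.Perm.mul_apply, Equiv.swap_apply_def, Fin.ext_iff]
  grind

/-- The values of `μ` on the generators: `s_i ↦ 1` and `ρ_i ↦ (i, i + 1)`. -/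
def muGen {n : ℕ} : VBGen n → Equiv.Perm (Fin n)
  | VBGen.sigma _ => 1
  | VBGen.rho i => adjSwap i

theorem muGen_rels {n : ℕ} :
    ∀ w ∈ flatVirtualBraidRels n, FreeGroup.lift (muGen (n := n)) w = 1 := by
  rintro w (hw | ⟨i, rfl⟩)
  · cases hw with
    | sigma_braid i j h => simp [VBGen.s, muGen]
    | sigma_comm i j h => simp [VBGen.s, muGen]
    | rho_braid i j h =>
      rw [map_mul, map_inv, mul_inv_eq_one]
      simpa [VBGen.r, muGen] using adjSwap_braid i j h
    | rho_comm i j h =>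
      rw [map_mul, map_inv, mul_inv_eq_one]
      simpa [VBGen.r, muGen] using adjSwap_comm i j h
    | rho_sq i => simp [VBGen.r, muGen, adjSwap, pow_two]
    | mixed_comm i j h => simp [VBGen.s, VBGen.r, muGen]
    | mixed_braid i j h => simp [VBGen.s, VBGen.r, muGen]
  · simp [VBGen.s, muGen]

/-- The homomorphism `μ : FVB_n → S_n` with `μ(s_i) = 1` and `μ(ρ_i) = (i, i + 1)`. -/
def mu (n : ℕ) : FVB n →* Equiv.Perm (Fin n) := PresentedGroup.toGroup muGen_rels

end FVB

/-- The group `FH_n`, the kernel of `μ : FVB_n → S_n`. -/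
abbrev FH (n : ℕ) : Subgroup (FVB n) := (FVB.mu n).ker

/-- A group is linear if it embeds into `GL_m(K)` for some field `K` and some natural
number `m`. -/
def IsLinearGroup.{u} (G : Type u) [Group G] : Prop :=
  ∃ (K : Type u) (_ : Field K) (m : ℕ) (φ : G →* Matrix.GeneralLinearGroup (Fin m) K),
    Function.Injective φ

/-! For an ordered pair `b = (i, j)` of distinct points let `x b` be the conjugate of a generator
`s_k` by the image of a permutation that carries the neighbours `k`, `k + 1` to `i`, `j`. This is
independent of the permutation (`iota_conj_s`): along a word that shortens the permutation, the
mixed relations move `s_k` past each `ρ_t` or each product `ρ_k ρ_t`. Since `S_n` is transitive on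
tuples of distinct points, the relations among the `s_k` spread to all pairs: `x b` and `x c`
commute for disjoint pairs and satisfy the braid relation for `(i, j)`, `(j, l)` with `i ≠ l`; other
distinct pairs get no relation. These are Coxeter relations, preserved by `S_n`. The semidirect
product of their Coxeter group with `S_n` satisfies the relations of `FVB_n`, and the two evident
homomorphisms are mutually inverse (`semiEquiv`); `μ` becomes the projection, so its kernel is the
Coxeter group.

For linearity, the geometric representation of a Coxeter group is faithful, because a simple root
goes to a nonnegative combination of simple roots unless its index is a right descent
(`apply_mem_closure`). `S_n` permutes the simple roots compatibly, so the representation extends to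
`FVB_n`; adding the permutation representation of `S_n` makes faithfulness evident. The same
positivity, applied to the vectors `e_i - e_{i + 1}`, gives the Coxeter presentation of `S_n`, hence
the section of `μ`, and describes descents of permutations. -/

namespace CoxeterSystem

/-! ### Root families and positivity -/

variable {B W U : Type*} [Group W] {M : CoxeterMatrix B} (cs : CoxeterSystem M W)
  [AddCommGroup U] [Module ℚ U]

theorem simple_comm_of_two {i j : B} (h : M i j = 2) :
    cs.simple i * cs.simple j = cs.simple j * cs.simple i := by
  have := cs.simple_mul_simple_pow i j
  rw [h, pow_two, mul_eq_one_iff_eq_inv] at this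
  simpa using this

theorem simple_braid_of_three {i j : B} (h : M i j = 3) :
    cs.simple i * cs.simple j * cs.simple i = cs.simple j * cs.simple i * cs.simple j := by
  have := cs.simple_mul_simple_pow i j
  rw [h, pow_succ, pow_two] at this
  rw [← mul_inv_eq_one]
  simpa [mul_assoc] using this

/-- A family of vectors on which the simple reflections act as on the simple roots. All orders
are at most `3` or infinite. -/
structure IsRootFamily (ρ : W →* Module.End ℚ U) (a : B → U) : Prop where
  le_three : ∀ i j, M i j ≤ 3
  apply_self : ∀ i, ρ (cs.simple i) (a i) = -a i
  apply_of_two : ∀ i j, M i j = 2 → ρ (cs.simple i) (a j) = a j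
  apply_of_three : ∀ i j, M i j = 3 → ρ (cs.simple i) (a j) = a j + a i
  apply_of_zero : ∀ i j, M i j = 0 → ρ (cs.simple i) (a j) = a j + 2 • a i

namespace IsRootFamily

variable {cs} {ρ : W →* Module.End ℚ U} {a : B → U}

/-- Induction on length, stripping a right descent. For an infinite order the stripped reflection
produces further roots of an infinite dihedral group, so the induction must carry all the vectors
`(k + 1) a_i + k a_j` along with `a_i`. -/
theorem apply_mem_closure_aux (h : cs.IsRootFamily ρ a) (n : ℕ) :
    ∀ w : W, cs.length w = n → ∀ i, ¬ cs.IsRightDescent w i →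
      ρ w (a i) ∈ AddSubmonoid.closure (Set.range a) ∧
      ∀ j, M i j = 0 → ∀ k : ℕ,
        ρ w ((k + 1) • a i + k • a j) ∈ AddSubmonoid.closure (Set.range a) := by
  induction n using Nat.strong_induction_on with
  | _ n ih =>
  intro w hw
  have basic : ∀ i, ¬ cs.IsRightDescent w i →
      ρ w (a i) ∈ AddSubmonoid.closure (Set.range a) := by
    intro i hi
    by_cases h1 : w = 1
    · subst h1
      simpa using AddSubmonoid.subset_closure (Set.mem_range_self i)
    obtain ⟨j, hj⟩ := cs.exists_rightDescent_of_ne_one h1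
    have hij : i ≠ j := by rintro rfl; exact hi hj
    obtain ⟨v, rfl⟩ : ∃ v, w = v * cs.simple j := ⟨w * cs.simple j, by simp⟩
    rw [cs.isRightDescent_iff] at hj
    rw [cs.not_isRightDescent_iff] at hi
    simp only [simple_mul_simple_cancel_right] at hj
    have hvj : ¬ cs.IsRightDescent v j := by
      rw [cs.not_isRightDescent_iff]; omega
    have hM1 : M j i ≠ 1 := M.off_diagonal j i hij.symm
    have hM3 := h.le_three j i
    rw [map_mul, Module.End.mul_apply]
    have hcases : M j i = 0 ∨ M j i = 2 ∨ M j i = 3 := by omega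
    rcases hcases with h0 | h2 | h3
    · rw [h.apply_of_zero j i h0]
      -- The vector `a_i + 2 a_j` is the case `k = 1` of the second claim with `i` and `j`
      -- exchanged.
      have := ((ih _ (by omega) v rfl j hvj).2 i h0 1)
      simpa [add_comm] using this
    · rw [h.apply_of_two j i h2]
      refine (ih _ (by omega) v rfl i ?_).1
      rw [mul_assoc, cs.simple_comm_of_two h2, ← mul_assoc] at hi
      rcases cs.length_mul_simple v i with h' | h'
      · rwa [cs.not_isRightDescent_iff]
      · have := cs.length_mul_le (v * cs.simple i) (cs.simple j)
        rw [cs.length_simple] at this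
        omega
    · rw [h.apply_of_three j i h3]
      by_cases hvi : cs.IsRightDescent v i
      · obtain ⟨u, rfl⟩ : ∃ u, v = u * cs.simple i := ⟨v * cs.simple i, by simp⟩
        rw [cs.isRightDescent_iff] at hvi
        simp only [simple_mul_simple_cancel_right] at hvi
        -- The reflection `s_i` takes `a_i + a_j` to `a_j`. By the braid relation, a descent of `u`
        -- at `j` would make `w s_i` too short.
        have e : ρ (u * cs.simple i) (a i + a j) = ρ u (a j) := by
          rw [map_mul, Module.End.mul_apply, map_add, h.apply_self,
            h.apply_of_three i j (M.symmetric i j ▸ h3)]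
          simp
        rw [e]
        refine (ih _ (by omega) u rfl j ?_).1
        have hb : u * cs.simple i * cs.simple j * cs.simple i =
            u * cs.simple j * cs.simple i * cs.simple j := by
          simpa [mul_assoc] using congrArg (u * ·) (cs.simple_braid_of_three (M.symmetric i j ▸ h3))
        rw [hb] at hi
        rcases cs.length_mul_simple u j with h' | h'
        · rwa [cs.not_isRightDescent_iff]
        · have h4 := cs.length_mul_le (u * cs.simple j * cs.simple i) (cs.simple j)
          have h5 := cs.length_mul_le (u * cs.simple j) (cs.simple i)
          rw [cs.length_simple] at h4 h5
          omega
      · rw [map_add]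
        exact add_mem (ih _ (by omega) v rfl i hvi).1 (ih _ (by omega) v rfl j hvj).1
  refine fun i hi => ⟨basic i hi, fun j hj k => ?_⟩
  by_cases hwj : cs.IsRightDescent w j
  · obtain ⟨v, rfl⟩ : ∃ v, w = v * cs.simple j := ⟨w * cs.simple j, by simp⟩
    rw [cs.isRightDescent_iff] at hwj
    simp only [simple_mul_simple_cancel_right] at hwj
    have hvj : ¬ cs.IsRightDescent v j := by
      rw [cs.not_isRightDescent_iff]; omega
    -- The reflection `s_j` takes `(k + 1) a_i + k a_j` to `(k + 2) a_j + (k + 1) a_i`, which has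
    -- the same shape with `i` and `j` exchanged.
    have := (ih _ (by omega) v rfl j hvj).2 i (M.symmetric i j ▸ hj) (k + 1)
    rw [map_mul, Module.End.mul_apply, map_add, map_nsmul, map_nsmul, h.apply_self,
      h.apply_of_zero j i (M.symmetric i j ▸ hj)]
    convert this using 2
    module
  · rw [map_add, map_nsmul, map_nsmul]
    exact add_mem (nsmul_mem (basic i hi) _) (nsmul_mem (basic j hwj) _)

theorem apply_mem_closure (h : cs.IsRootFamily ρ a) {w : W} {i : B}
    (hi : ¬ cs.IsRightDescent w i) : ρ w (a i) ∈ AddSubmonoid.closure (Set.range a) :=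
  (h.apply_mem_closure_aux _ w rfl i hi).1

/-- A representation with a root family on which some functional is positive is faithful. -/
theorem injective (h : cs.IsRootFamily ρ a) (f : U →ₗ[ℚ] ℚ) (hf : ∀ i, 0 < f (a i)) :
    Function.Injective ρ := by
  rw [injective_iff_map_eq_one]
  intro w hw
  by_contra h1
  obtain ⟨i, hi⟩ := cs.exists_rightDescent_of_ne_one h1
  -- If `w` acts trivially, this vector is `-a_i`, on which `f` is negative.
  have hmem : ρ (w * cs.simple i) (a i) ∈ AddSubmonoid.closure (Set.range a) := by
    apply h.apply_mem_closure
    rw [cs.isRightDescent_iff] at hi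
    rw [cs.not_isRightDescent_iff, simple_mul_simple_cancel_right]
    omega
  rw [map_mul, hw, one_mul, h.apply_self] at hmem
  have hnonneg : ∀ x ∈ AddSubmonoid.closure (Set.range a), 0 ≤ f x := by
    intro x hx
    induction hx using AddSubmonoid.closure_induction with
    | mem x hx => obtain ⟨j, rfl⟩ := hx; exact (hf j).le
    | zero => simp
    | add x y _ _ hx hy => rw [map_add]; exact add_nonneg hx hy
  have := hnonneg _ hmem
  rw [map_neg] at this
  linarith [hf i]

end IsRootFamily
end CoxeterSystem

/-! ### The geometric representation -/

namespace CoxeterMatrix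

variable {B : Type*} [Fintype B] [DecidableEq B] (M : CoxeterMatrix B)

/-- The Cartan integer attached to an order `1`, `2`, `3` or `∞`, the last being encoded by `0`. -/
def cartanEntry : ℕ → ℚ
  | 0 => -2
  | 1 => 2
  | 2 => 0
  | _ => -1

/-- The coroot of index `i`, in the coordinates given by the simple roots. -/
def coroot (i : B) : (B → ℚ) →ₗ[ℚ] ℚ :=
  ∑ j, cartanEntry (M i j) • LinearMap.proj j

@[simp]
theorem coroot_single (i j : B) : M.coroot i (Pi.single j 1) = cartanEntry (M i j) := by
  simp [coroot, Pi.single_apply]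

/-- The simple reflection of index `i` of the geometric representation. -/
def titsReflection (i : B) : Module.End ℚ (B → ℚ) :=
  1 - (M.coroot i).smulRight (Pi.single i 1)

theorem titsReflection_apply (i : B) (v : B → ℚ) :
    M.titsReflection i v = v - M.coroot i v • Pi.single i 1 := rfl

theorem titsReflection_single (i j : B) :
    M.titsReflection i (Pi.single j 1) = Pi.single j 1 - cartanEntry (M i j) • Pi.single i 1 := by
  rw [titsReflection_apply, coroot_single]

theorem titsReflection_isLiftable (hM : ∀ i j, M i j ≤ 3) : M.IsLiftable M.titsReflection := by
  intro i j
  have hij := hM i j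
  have hs := M.symmetric i j
  refine LinearMap.ext fun v => ?_
  obtain h | h | h | h : M i j = 0 ∨ M i j = 1 ∨ M i j = 2 ∨ M i j = 3 := by omega
  · simp [h]
  · obtain rfl : i = j := by
      by_contra h'
      exact M.off_diagonal i j h' h
    simp [titsReflection_apply, cartanEntry]
    module
  · simp [titsReflection_apply, pow_succ, ← hs, h, cartanEntry]
    module
  · simp [titsReflection_apply, pow_succ, ← hs, h, cartanEntry]
    module

variable {M} {W : Type*} [Group W] (cs : CoxeterSystem M W)

/-- The geometric representation of a Coxeter group all of whose orders are at most `3` or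
infinite. -/
noncomputable def titsRep (hM : ∀ i j, M i j ≤ 3) : W →* Module.End ℚ (B → ℚ) :=
  cs.lift ⟨M.titsReflection, M.titsReflection_isLiftable hM⟩

@[simp]
theorem titsRep_simple (hM : ∀ i j, M i j ≤ 3) (i : B) :
    titsRep cs hM (cs.simple i) = M.titsReflection i :=
  cs.lift_apply_simple _ i

theorem titsRep_injective (hM : ∀ i j, M i j ≤ 3) : Function.Injective (titsRep cs hM) := by
  refine CoxeterSystem.IsRootFamily.injective (cs := cs) (a := fun i => Pi.single i 1)
    ⟨hM, ?_, ?_, ?_, ?_⟩ (∑ i, LinearMap.proj i) ?_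
  · intro i
    rw [titsRep_simple, titsReflection_single, M.diagonal, cartanEntry]
    module
  · intro i j h
    rw [titsRep_simple, titsReflection_single, h, cartanEntry]
    module
  · intro i j h
    rw [titsRep_simple, titsReflection_single, h]
    simp only [cartanEntry]
    module
  · intro i j h
    rw [titsRep_simple, titsReflection_single, h, cartanEntry]
    module
  · intro i
    simp [Pi.single_apply]

end CoxeterMatrix

/-- The permutation representation on the functions on `α`. -/
def coordRep (α : Type*) : Equiv.Perm α →* Module.End ℚ (α → ℚ) where
  toFun σ := LinearMap.funLeft ℚ ℚ σ.symm
  map_one' := rfl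
  map_mul' _ _ := rfl

theorem coordRep_apply {α : Type*} (σ : Equiv.Perm α) (v : α → ℚ) (x : α) :
    coordRep α σ v x = v (σ.symm x) := rfl

@[simp]
theorem coordRep_single {α : Type*} [DecidableEq α] (σ : Equiv.Perm α) (x : α) :
    coordRep α σ (Pi.single x 1) = Pi.single (σ x) 1 := by
  ext y
  simp [coordRep_apply, Pi.single_apply, Equiv.symm_apply_eq]

theorem coordRep_injective (α : Type*) : Function.Injective (coordRep α) := by
  classical
  intro σ τ h
  ext1 x
  have := congrFun (congrArg (fun g => g (Pi.single x 1)) h) (σ x)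
  by_contra hne
  simp [hne] at this

/-! ### The symmetric group as a Coxeter group, and the section of `μ` -/

namespace FVB

variable {n : ℕ}

section Relations

theorem rel_eq {u v : FreeGroup (VBGen n)} (h : VBRel n (u * v⁻¹)) :
    PresentedGroup.mk (flatVirtualBraidRels n) u = PresentedGroup.mk _ v := by
  rw [← mul_inv_eq_one, ← map_inv, ← map_mul]
  exact PresentedGroup.one_of_mem (Or.inl h)

theorem s_mul_s (i : Fin (n - 1)) : s i * s i = 1 := by
  have : PresentedGroup.mk (flatVirtualBraidRels n) (VBGen.s i ^ 2) = 1 :=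
    PresentedGroup.one_of_mem (Or.inr ⟨i, rfl⟩)
  rwa [pow_two, map_mul] at this

theorem r_mul_r (i : Fin (n - 1)) : r i * r i = 1 := by
  have : PresentedGroup.mk (flatVirtualBraidRels n) (VBGen.r i ^ 2) = 1 :=
    PresentedGroup.one_of_mem (Or.inl (.rho_sq i))
  rwa [pow_two, map_mul] at this

@[simp]
theorem r_inv (i : Fin (n - 1)) : (r i)⁻¹ = r i := inv_eq_of_mul_eq_one_left (r_mul_r i)

theorem s_braid {i j : Fin (n - 1)} (h : VBGen.Next i j) : s i * s j * s i = s j * s i * s j :=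
  rel_eq (.sigma_braid i j h)

theorem s_comm {i j : Fin (n - 1)} (h : VBGen.Far i j) : s i * s j = s j * s i :=
  rel_eq (.sigma_comm i j h)

theorem r_braid {i j : Fin (n - 1)} (h : VBGen.Next i j) : r i * r j * r i = r j * r i * r j :=
  rel_eq (.rho_braid i j h)

theorem r_comm {i j : Fin (n - 1)} (h : VBGen.Far i j) : r i * r j = r j * r i :=
  rel_eq (.rho_comm i j h)

theorem s_r_comm {i j : Fin (n - 1)} (h : VBGen.Far i j) : s i * r j = r j * s i :=
  rel_eq (.mixed_comm i j h)

theorem r_r_s {i j : Fin (n - 1)} (h : VBGen.Next i j) : r i * r j * s i = s j * r i * r j :=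
  rel_eq (.mixed_braid i j h)

end Relations

theorem isLiftable_A {G : Type*} [Group G] {g : Fin (n - 1) → G} (sq : ∀ i, g i * g i = 1)
    (braid : ∀ i j, VBGen.Next i j → g i * g j * g i = g j * g i * g j)
    (comm : ∀ i j, VBGen.Far i j → g i * g j = g j * g i) :
    (CoxeterMatrix.A (n - 1)).IsLiftable g := by
  have inv : ∀ i, (g i)⁻¹ = g i := fun i => inv_eq_of_mul_eq_one_left (sq i)
  have braid' : ∀ i j, g i * g j * g i = g j * g i * g j → (g i * g j) ^ 3 = 1 := by
    intro i j h
    calc (g i * g j) ^ 3 = (g i * g j * g i) * (g j * g i * g j) := by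
          simp only [pow_succ, pow_zero, one_mul, mul_assoc]
      _ = (g j * g i * g j) * (g j * g i * g j) := by rw [h]
      _ = g j * (g i * (g j * g j) * g i) * g j := by simp only [mul_assoc]
      _ = 1 := by simp [sq]
  intro i j
  change (g i * g j) ^ (if i = j then 1 else
    (if (j : ℕ) + 1 = i ∨ (i : ℕ) + 1 = j then 3 else 2)) = 1
  split_ifs with h1 h2
  · rw [h1, pow_one, sq]
  · rcases h2 with h2 | h2
    · exact braid' i j (braid j i h2.symm).symm
    · exact braid' i j (braid i j h2.symm)
  · have hc : g i * g j = g j * g i := by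
      refine comm i j ?_
      have : (i : ℕ) ≠ j := fun h => h1 (Fin.ext h)
      unfold VBGen.Far
      omega
    rw [pow_two]
    nth_rw 2 [hc]
    rw [mul_assoc, ← mul_assoc (g j), sq, one_mul, sq]

theorem adjSwap_mul_self (i : Fin (n - 1)) : adjSwap i * adjSwap i = 1 :=
  Equiv.swap_mul_self _ _

/-- The homomorphism from the Coxeter group of type `A` to the symmetric group. -/
noncomputable def typeAHom (n : ℕ) : (CoxeterMatrix.A (n - 1)).Group →* Equiv.Perm (Fin n) :=
  (CoxeterMatrix.A (n - 1)).toCoxeterSystem.lift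
    ⟨adjSwap, isLiftable_A adjSwap_mul_self adjSwap_braid adjSwap_comm⟩

@[simp]
theorem typeAHom_simple (i : Fin (n - 1)) :
    typeAHom n ((CoxeterMatrix.A (n - 1)).simple i) = adjSwap i :=
  CoxeterSystem.lift_apply_simple _ _ i

/-- The left point of the neighbouring pair with index `i`. -/
def lo (i : Fin (n - 1)) : Fin n := ⟨i.val, by omega⟩

/-- The right point of the neighbouring pair with index `i`. -/
def hi (i : Fin (n - 1)) : Fin n := ⟨i.val + 1, by omega⟩

theorem lo_ne_hi (i : Fin (n - 1)) : lo i ≠ hi i := by simp [lo, hi, Fin.ext_iff]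

@[simp] theorem adjSwap_lo (i : Fin (n - 1)) : adjSwap i (lo i) = hi i := Equiv.swap_apply_left _ _

@[simp] theorem adjSwap_hi (i : Fin (n - 1)) : adjSwap i (hi i) = lo i := Equiv.swap_apply_right _ _

theorem adjSwap_of_ne {i : Fin (n - 1)} {x : Fin n} (h1 : x.val ≠ i.val) (h2 : x.val ≠ i.val + 1) :
    adjSwap i x = x :=
  Equiv.swap_apply_of_ne_of_ne (fun h => h1 (congrArg Fin.val h)) (fun h => h2 (congrArg Fin.val h))

/-- The vectors `e_i - e_{i + 1}`. -/
def rootA (i : Fin (n - 1)) : Fin n → ℚ := Pi.single (lo i) 1 - Pi.single (hi i) 1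

/-- The functional `v ↦ - ∑ k v_k`, which is `1` on every `e_i - e_{i + 1}`. -/
def heightA (n : ℕ) : (Fin n → ℚ) →ₗ[ℚ] ℚ := ∑ k : Fin n, (-(k.val : ℚ)) • LinearMap.proj k

theorem heightA_single (x : Fin n) : heightA n (Pi.single x 1) = -(x.val : ℚ) := by
  simp [heightA, Pi.single_apply]

theorem heightA_rootA (i : Fin (n - 1)) : heightA n (rootA i) = 1 := by
  simp [rootA, heightA_single, lo, hi]

/-- The Coxeter system is left general because the family is used twice: for the abstract group of
type `A`, to show that it embeds in `S_n`, and then for `S_n` itself, to read off descents. -/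
theorem isRootFamily_rootA {W : Type*} [Group W] (cs : CoxeterSystem (CoxeterMatrix.A (n - 1)) W)
    (f : W →* Equiv.Perm (Fin n)) (hf : ∀ i, f (cs.simple i) = adjSwap i) :
    cs.IsRootFamily ((coordRep (Fin n)).comp f) rootA := by
  unfold rootA
  refine ⟨?_, ?_, ?_, ?_, ?_⟩
  · intro i j
    change (if i = j then 1 else (if (j : ℕ) + 1 = i ∨ (i : ℕ) + 1 = j then 3 else 2)) ≤ 3
    split_ifs <;> omega
  · intro i
    simp [hf]
  · intro i j h
    change (if i = j then 1 else (if (j : ℕ) + 1 = i ∨ (i : ℕ) + 1 = j then 3 else 2)) = 2 at h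
    split_ifs at h with h1 h2
    · omega
    · omega
    have : (i : ℕ) ≠ j := fun h => h1 (Fin.ext h)
    have e1 : adjSwap i (lo j) = lo j := adjSwap_of_ne (by simp [lo]; omega) (by simp [lo]; omega)
    have e2 : adjSwap i (hi j) = hi j := adjSwap_of_ne (by simp [hi]; omega) (by simp [hi]; omega)
    simp [hf, e1, e2]
  · intro i j h
    change (if i = j then 1 else (if (j : ℕ) + 1 = i ∨ (i : ℕ) + 1 = j then 3 else 2)) = 3 at h
    obtain h2 : (j : ℕ) + 1 = i ∨ (i : ℕ) + 1 = j := by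
      by_contra h2
      rw [if_neg h2] at h
      split_ifs at h <;> omega
    rcases h2 with h2 | h2
    · have e1 : adjSwap i (lo j) = lo j := adjSwap_of_ne (by simp [lo]; omega) (by simp [lo]; omega)
      have e2 : hi j = lo i := Fin.ext h2
      simp [hf, e1, e2]
    · have e1 : adjSwap i (hi j) = hi j := adjSwap_of_ne (by simp [hi]; omega) (by simp [hi]; omega)
      have e2 : lo j = hi i := Fin.ext h2.symm
      simp [hf, e1, e2]
  · intro i j h
    change (if i = j then 1 else (if (j : ℕ) + 1 = i ∨ (i : ℕ) + 1 = j then 3 else 2)) = 0 at h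
    split_ifs at h

theorem typeAHom_injective (n : ℕ) : Function.Injective (typeAHom n) := by
  have h := isRootFamily_rootA (CoxeterMatrix.A (n - 1)).toCoxeterSystem (typeAHom n) (by simp)
  exact Function.Injective.of_comp (f := coordRep (Fin n))
    (h.injective (heightA n) fun i => by simp [heightA_rootA])

theorem typeAHom_surjective (n : ℕ) : Function.Surjective (typeAHom n) := by
  cases n with
  | zero => exact fun σ => ⟨1, Subsingleton.elim _ _⟩
  | succ m =>
    have h : Submonoid.closure (Set.range (adjSwap (n := m + 1))) ≤
        MonoidHom.mrange (typeAHom _) := by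
      rw [Submonoid.closure_le]
      rintro _ ⟨i, rfl⟩
      exact ⟨_, typeAHom_simple i⟩
    have h' : Submonoid.closure (Set.range (adjSwap (n := m + 1))) = ⊤ :=
      -- Here `m + 1 - 1` reduces to `m`, so both families of transpositions agree by definition.
      Equiv.Perm.mclosure_swap_castSucc_succ m
    intro σ
    exact h (h' ▸ Submonoid.mem_top σ)

/-- The symmetric group as a Coxeter group of type `A`. -/
noncomputable def permSystem (n : ℕ) :
    CoxeterSystem (CoxeterMatrix.A (n - 1)) (Equiv.Perm (Fin n)) :=
  (CoxeterMatrix.A (n - 1)).toCoxeterSystem.map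
    (MulEquiv.ofBijective (typeAHom n) ⟨typeAHom_injective n, typeAHom_surjective n⟩)

@[simp]
theorem permSystem_simple (i : Fin (n - 1)) : (permSystem n).simple i = adjSwap i :=
  typeAHom_simple i

/-- The homomorphism `S_n → FVB_n` with `(i, i + 1) ↦ ρ_i`. -/
noncomputable def iota (n : ℕ) : Equiv.Perm (Fin n) →* FVB n :=
  (permSystem n).lift ⟨r, isLiftable_A r_mul_r (fun _ _ => r_braid) (fun _ _ => r_comm)⟩

@[simp]
theorem iota_adjSwap (i : Fin (n - 1)) : iota n (adjSwap i) = r i := by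
  rw [← permSystem_simple]
  exact CoxeterSystem.lift_apply_simple _ _ i

@[simp] theorem mu_s (i : Fin (n - 1)) : mu n (s i) = 1 := PresentedGroup.toGroup.of muGen_rels

@[simp] theorem mu_r (i : Fin (n - 1)) : mu n (r i) = adjSwap i :=
  PresentedGroup.toGroup.of muGen_rels

theorem perm_hom_ext {G : Type*} [Monoid G] {f g : Equiv.Perm (Fin n) →* G}
    (h : ∀ i, f (adjSwap i) = g (adjSwap i)) : f = g :=
  (permSystem n).ext_simple (by simpa using h)

@[simp]
theorem mu_iota (σ : Equiv.Perm (Fin n)) : mu n (iota n σ) = σ := by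
  have : (mu n).comp (iota n) = MonoidHom.id _ := perm_hom_ext (by simp)
  exact DFunLike.congr_fun this σ

end FVB

theorem SemidirectProduct.exists_mulEquiv_of_section {G Q : Type*} [Group G] [Group Q]
    (f : G →* Q) (g : Q →* G) (h : ∀ q, f (g q) = q) :
    ∃ (φ : Q →* MulAut f.ker) (e : f.ker ⋊[φ] Q ≃* G),
      (∀ x : f.ker, e (SemidirectProduct.inl x) = x) ∧
      (∀ q, e (SemidirectProduct.inr q) = g q) ∧ ∀ x, f (e x) = x.right := by
  let φ : Q →* MulAut f.ker := MulAut.conjNormal.comp g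
  let F : f.ker ⋊[φ] Q →* G := SemidirectProduct.lift f.ker.subtype g (by
    intro q
    ext x
    simp [φ])
  have hF : ∀ x, F x = x.left * g x.right := fun _ => rfl
  have hfF : ∀ x, f (F x) = x.right := by
    intro x
    rw [hF, map_mul, h, MonoidHom.mem_ker.1 x.left.2, one_mul]
  have hbij : Function.Bijective F := by
    constructor
    · rw [injective_iff_map_eq_one]
      intro x hx
      have hr : x.right = 1 := by rw [← hfF, hx, map_one]
      rw [hF, hr, map_one, mul_one] at hx
      exact SemidirectProduct.ext (Subtype.ext hx) hr
    · intro y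
      refine ⟨⟨⟨y * g (f y)⁻¹, ?_⟩, f y⟩, ?_⟩
      · simp [MonoidHom.mem_ker, h]
      · simp [hF]
  exact ⟨φ, MulEquiv.ofBijective F hbij, fun x => by simp [F], fun q => by simp [F], hfF⟩

/-! ### Descents of permutations and conjugates of the `s_k` -/

namespace FVB

variable {n : ℕ}

/-- The image of the root `e_t - e_{t + 1}` is a nonnegative combination of simple roots, so its
height `σ (hi t) - σ (lo t)` is nonnegative. -/
theorem lt_of_not_isRightDescent {σ : Equiv.Perm (Fin n)} {t : Fin (n - 1)}
    (h : ¬ (permSystem n).IsRightDescent σ t) : σ (lo t) < σ (hi t) := by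
  have hf := isRootFamily_rootA (permSystem n) (MonoidHom.id _) (by simp)
  have hpos := hf.apply_mem_closure h
  have hnonneg : 0 ≤ heightA n (coordRep (Fin n) σ (rootA t)) := by
    refine AddSubmonoid.closure_induction (motive := fun x _ => 0 ≤ heightA n x) ?_ ?_ ?_ hpos
    · rintro _ ⟨j, rfl⟩
      simp [heightA_rootA]
    · simp
    · intro x y _ _ hx hy
      rw [map_add]
      exact add_nonneg hx hy
  simp only [rootA, map_sub, coordRep_single, heightA_single] at hnonneg
  refine lt_of_le_of_ne ?_ (σ.injective.ne (lo_ne_hi t))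
  rw [Fin.le_def]
  exact_mod_cast (by linarith : ((σ (lo t)).val : ℚ) ≤ (σ (hi t)).val)

theorem isRightDescent_iff_lt {σ : Equiv.Perm (Fin n)} {t : Fin (n - 1)} :
    (permSystem n).IsRightDescent σ t ↔ σ (hi t) < σ (lo t) := by
  constructor
  · intro h
    have h' : ¬ (permSystem n).IsRightDescent (σ * (permSystem n).simple t) t := by
      rw [CoxeterSystem.isRightDescent_iff] at h
      rw [CoxeterSystem.not_isRightDescent_iff, CoxeterSystem.simple_mul_simple_cancel_right]
      omega
    simpa using lt_of_not_isRightDescent h'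
  · intro h
    by_contra h'
    exact absurd (lt_of_not_isRightDescent h') h.not_gt

theorem length_mul_adjSwap_lt {σ : Equiv.Perm (Fin n)} {t : Fin (n - 1)}
    (h : σ (hi t) < σ (lo t)) :
    (permSystem n).length (σ * adjSwap t) < (permSystem n).length σ := by
  have := isRightDescent_iff_lt.2 h
  rwa [CoxeterSystem.IsRightDescent, permSystem_simple] at this

/-- A permutation that carries one pair of neighbours to another conjugates the generators. -/
theorem iota_conj_s (m : ℕ) : ∀ (σ : Equiv.Perm (Fin n)), (permSystem n).length σ = m →
    ∀ k l : Fin (n - 1), σ (lo k) = lo l → σ (hi k) = hi l →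
      iota n σ * s k = s l * iota n σ := by
  induction m using Nat.strong_induction_on with
  | _ m ih =>
  intro σ hm k l hlo hhi
  by_cases h1 : σ = 1
  · subst h1
    obtain rfl : k = l := Fin.ext (by simpa [lo] using hlo)
    simp
  obtain ⟨t, ht⟩ := (permSystem n).exists_rightDescent_of_ne_one h1
  rw [isRightDescent_iff_lt] at ht
  -- `σ` preserves the order of the pair `k`, so `k` is not a descent.
  have htk : t ≠ k := by
    rintro rfl
    rw [hlo, hhi, Fin.lt_def] at ht
    simp [lo, hi] at ht
  have hτ := length_mul_adjSwap_lt ht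
  have hσ : iota n σ = iota n (σ * adjSwap t) * r t := by simp [mul_assoc, r_mul_r]
  -- For `t` adjacent to `k`, two letters are removed at once: a mixed relation turns `s_k` into
  -- `s_t`, and the shorter `τ` carries the pair `t` to the pair `l`.
  have step : ∀ τ : Equiv.Perm (Fin n), τ * adjSwap k * adjSwap t = σ →
      (permSystem n).length τ < m → τ (lo t) = lo l → τ (hi t) = hi l →
      r k * r t * s k = s t * r k * r t → iota n σ * s k = s l * iota n σ := by
    intro τ hτ hlen h3 h4 h5
    have := ih _ hlen τ rfl t l h3 h4
    rw [← hτ, map_mul, map_mul, iota_adjSwap, iota_adjSwap]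
    calc iota n τ * r k * r t * s k = iota n τ * (r k * r t * s k) := by simp only [mul_assoc]
      _ = iota n τ * s t * (r k * r t) := by rw [h5]; simp only [mul_assoc]
      _ = _ := by rw [this]; simp only [mul_assoc]
  have hcancel : σ * adjSwap t * adjSwap k * adjSwap k * adjSwap t = σ := by
    simp [mul_assoc, adjSwap_mul_self]
  have htk' : (t : ℕ) ≠ k := fun h => htk (Fin.ext h)
  obtain hf | hn | hn : VBGen.Far k t ∨ VBGen.Next k t ∨ VBGen.Next t k := by
    unfold VBGen.Far VBGen.Next
    omega
  · have e1 : adjSwap t (lo k) = lo k :=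
      adjSwap_of_ne htk'.symm (by unfold VBGen.Far at hf; simp only [lo]; omega)
    have e2 : adjSwap t (hi k) = hi k := by
      unfold VBGen.Far at hf
      exact adjSwap_of_ne (by simp only [hi]; omega) (by simp only [hi]; omega)
    have := ih _ (hm ▸ hτ) (σ * adjSwap t) rfl k l (by simp [e1, hlo]) (by simp [e2, hhi])
    rw [hσ, mul_assoc, ← s_r_comm hf, ← mul_assoc, this, mul_assoc]
  · have e : lo t = hi k := Fin.ext hn
    have e1 : adjSwap t (lo k) = lo k :=
      adjSwap_of_ne htk'.symm (by unfold VBGen.Next at hn; simp only [lo]; omega)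
    have e2 : adjSwap k (hi t) = hi t := by
      unfold VBGen.Next at hn
      exact adjSwap_of_ne (by simp only [hi]; omega) (by simp only [hi]; omega)
    have e3 : adjSwap t (hi k) = hi t := by rw [← e, adjSwap_lo]
    -- The value `σ (hi t)` is below `hi l` and differs from `lo l`. As these are consecutive, it is
    -- below `lo l`, so `k` is a descent of `σ * adjSwap t`.
    have hlt : (σ * adjSwap t) (hi k) < (σ * adjSwap t) (lo k) := by
      rw [Equiv.Perm.mul_apply, Equiv.Perm.mul_apply, e1, e3, hlo]
      have hne : σ (hi t) ≠ lo l := by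
        rw [← hlo]
        refine σ.injective.ne fun h => ?_
        have := congrArg Fin.val h
        unfold VBGen.Next at hn
        simp only [hi, lo] at this
        omega
      rw [e, hhi, Fin.lt_def] at ht
      have hne' := Fin.val_ne_of_ne hne
      rw [Fin.lt_def]
      simp only [hi, lo] at ht hne' ⊢
      omega
    refine step (σ * adjSwap t * adjSwap k) hcancel
      ((length_mul_adjSwap_lt hlt).trans (hm ▸ hτ)) ?_ ?_ (r_r_s hn)
    · simp [e, e1, hlo]
    · simp [e2, e, hhi]
  · have e : lo k = hi t := Fin.ext hn
    have e1 : adjSwap t (hi k) = hi k := by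
      unfold VBGen.Next at hn
      exact adjSwap_of_ne (by simp only [hi]; omega) (by simp only [hi]; omega)
    have e2 : adjSwap k (lo t) = lo t := by
      unfold VBGen.Next at hn
      exact adjSwap_of_ne (by simp only [lo]; omega) (by simp only [lo]; omega)
    have e3 : adjSwap k (hi t) = hi k := by rw [← e, adjSwap_lo]
    have hlt : (σ * adjSwap t) (hi k) < (σ * adjSwap t) (lo k) := by
      rw [Equiv.Perm.mul_apply, Equiv.Perm.mul_apply, e1, e, adjSwap_hi, hhi]
      have hne : σ (lo t) ≠ hi l := by
        rw [← hhi]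
        refine σ.injective.ne fun h => ?_
        have := congrArg Fin.val h
        unfold VBGen.Next at hn
        simp only [hi, lo] at this
        omega
      rw [← e, hlo, Fin.lt_def] at ht
      have hne' := Fin.val_ne_of_ne hne
      rw [Fin.lt_def]
      simp only [hi, lo] at ht hne' ⊢
      omega
    refine step (σ * adjSwap t * adjSwap k) hcancel
      ((length_mul_adjSwap_lt hlt).trans (hm ▸ hτ)) ?_ ?_ ?_
    · simp [e2, ← e, hlo]
    · simp [e3, e1, hhi]
    -- Inverting the mixed relation gives its mirror form, since all generators are involutions.
    · have := congrArg (·⁻¹) (r_r_s hn)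
      have hs : ∀ i : Fin (n - 1), (s i)⁻¹ = s i := fun i => inv_eq_of_mul_eq_one_left (s_mul_s i)
      simp only [mul_inv_rev, r_inv, hs, ← mul_assoc] at this
      exact this.symm

end FVB

/-! ### Symmetries of a Coxeter matrix -/

namespace CoxeterMatrix

variable {B Q : Type*} [Group Q] (M : CoxeterMatrix B)

/-- The action on a Coxeter group by automorphisms of its Coxeter matrix. -/
def groupHomOfEquiv (e : Equiv.Perm B) (he : ∀ i j, M (e i) (e j) = M i j) : M.Group →* M.Group :=
  M.toCoxeterSystem.lift ⟨fun i => M.simple (e i), fun i j => by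
    rw [← he]
    exact M.toCoxeterSystem.simple_mul_simple_pow _ _⟩

@[simp]
theorem groupHomOfEquiv_simple (e : Equiv.Perm B) (he : ∀ i j, M (e i) (e j) = M i j) (i : B) :
    M.groupHomOfEquiv e he (M.simple i) = M.simple (e i) :=
  CoxeterSystem.lift_apply_simple _ _ i

/-- An action on the index set that preserves the Coxeter matrix acts on the Coxeter group. -/
def autOfAction (act : Q →* Equiv.Perm B) (h : ∀ q i j, M (act q i) (act q j) = M i j) :
    Q →* MulAut M.Group where
  toFun q := MonoidHom.toMulEquiv (M.groupHomOfEquiv (act q) (h q))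
    (M.groupHomOfEquiv (act q⁻¹) (h q⁻¹))
    (M.toCoxeterSystem.ext_simple fun i => by simp)
    (M.toCoxeterSystem.ext_simple fun i => by simp)
  map_one' := by
    refine MulEquiv.toMonoidHom_injective (M.toCoxeterSystem.ext_simple fun i => ?_)
    simp
  map_mul' p q := by
    refine MulEquiv.toMonoidHom_injective (M.toCoxeterSystem.ext_simple fun i => ?_)
    simp

@[simp]
theorem autOfAction_simple (act : Q →* Equiv.Perm B)
    (h : ∀ q i j, M (act q i) (act q j) = M i j) (q : Q) (i : B) :
    M.autOfAction act h q (M.simple i) = M.simple (act q i) :=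
  M.groupHomOfEquiv_simple _ (h q) i

end CoxeterMatrix

/-! ### The Coxeter group of ordered pairs and the decomposition of `FVB_n` -/

namespace FVB

/-- The ordered pairs of distinct points. -/
abbrev Pair (n : ℕ) : Type := {p : Fin n × Fin n // p.1 ≠ p.2}

variable {n : ℕ}

/-- The order of the product of the generators attached to two pairs. -/
def pairOrder (b c : Pair n) : ℕ :=
  if b = c then 1
  else if b.1.2 = c.1.1 ∧ b.1.1 ≠ c.1.2 ∨ c.1.2 = b.1.1 ∧ c.1.1 ≠ b.1.2 then 3
  else if b.1.1 ≠ c.1.1 ∧ b.1.1 ≠ c.1.2 ∧ b.1.2 ≠ c.1.1 ∧ b.1.2 ≠ c.1.2 then 2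
  -- Pairs with a common source or a common target and opposite pairs remain; `0` encodes infinite
  -- order.
  else 0

/-- The Coxeter matrix of the group `FH_n`. -/
def pairMatrix (n : ℕ) : CoxeterMatrix (Pair n) where
  M := Matrix.of pairOrder
  isSymm := by
    ext b c
    simp only [Matrix.transpose_apply, Matrix.of_apply, pairOrder]
    grind
  diagonal b := by simp [pairOrder]
  off_diagonal b c h := by
    simp only [Matrix.of_apply, pairOrder]
    grind

theorem pairMatrix_apply (b c : Pair n) : pairMatrix n b c = pairOrder b c := rfl

theorem pairMatrix_le_three (b c : Pair n) : pairMatrix n b c ≤ 3 := by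
  rw [pairMatrix_apply, pairOrder]
  split_ifs <;> omega

/-- The action of the symmetric group on the pairs. -/
def pairAct (n : ℕ) : Equiv.Perm (Fin n) →* Equiv.Perm (Pair n) where
  toFun σ :=
    { toFun := fun b => ⟨(σ b.1.1, σ b.1.2), σ.injective.ne b.2⟩
      invFun := fun b => ⟨(σ.symm b.1.1, σ.symm b.1.2), σ.symm.injective.ne b.2⟩
      left_inv := fun b => by simp
      right_inv := fun b => by simp }
  map_one' := rfl
  map_mul' _ _ := rfl

@[simp]
theorem pairAct_mk (σ : Equiv.Perm (Fin n)) (i j : Fin n) (h : (i, j).1 ≠ (i, j).2) :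
    pairAct n σ ⟨(i, j), h⟩ = ⟨(σ i, σ j), σ.injective.ne h⟩ := rfl

theorem pairMatrix_pairAct (σ : Equiv.Perm (Fin n)) (b c : Pair n) :
    pairMatrix n (pairAct n σ b) (pairAct n σ c) = pairMatrix n b c := by
  obtain ⟨⟨b1, b2⟩, hb⟩ := b
  obtain ⟨⟨c1, c2⟩, hc⟩ := c
  simp [pairMatrix_apply, pairOrder, Subtype.ext_iff, Prod.ext_iff]

/-- The action of the symmetric group on the Coxeter group of the pairs. -/
def pairAut (n : ℕ) : Equiv.Perm (Fin n) →* MulAut (pairMatrix n).Group :=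
  (pairMatrix n).autOfAction (pairAct n) pairMatrix_pairAct

@[simp]
theorem pairAut_simple (σ : Equiv.Perm (Fin n)) (b : Pair n) :
    pairAut n σ ((pairMatrix n).simple b) = (pairMatrix n).simple (pairAct n σ b) :=
  CoxeterMatrix.autOfAction_simple _ _ _ σ b

/-- The pair of neighbours with index `i`. -/
def nextPair (i : Fin (n - 1)) : Pair n := ⟨(lo i, hi i), lo_ne_hi i⟩

/-- Transitivity on tuples of distinct points: it reduces relations among arbitrary pairs to
relations among neighbours at the first points. -/
theorem exists_perm_of_injective {m : ℕ} (y : Fin m → Fin n) (hy : Function.Injective y) :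
    ∃ (h : m ≤ n) (σ : Equiv.Perm (Fin n)), ∀ i, σ (Fin.castLE h i) = y i := by
  have h : m ≤ n := by simpa using Fintype.card_le_of_injective y hy
  exact ⟨h, Equiv.Perm.exists_extending_pair _ y (Fin.castLE_injective h) hy⟩

theorem exists_pairAct_nextPair (b : Pair n) :
    ∃ (p : Equiv.Perm (Fin n) × Fin (n - 1)), pairAct n p.1 (nextPair p.2) = b := by
  obtain ⟨⟨i, j⟩, hb⟩ := b
  obtain ⟨h, σ, hσ⟩ := exists_perm_of_injective ![i, j] (by
    rw [Function.Injective]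
    simp only [Fin.forall_fin_two]
    simpa [eq_comm] using hb)
  refine ⟨(σ, ⟨0, by omega⟩), Subtype.ext (Prod.ext ?_ ?_)⟩
  · exact hσ 0
  · exact hσ 1

theorem exists_pairAct_of_two {b c : Pair n} (h : pairMatrix n b c = 2) :
    ∃ (σ : Equiv.Perm (Fin n)) (k l : Fin (n - 1)), VBGen.Far k l ∧
      pairAct n σ (nextPair k) = b ∧ pairAct n σ (nextPair l) = c := by
  obtain ⟨⟨i, j⟩, hb⟩ := b
  obtain ⟨⟨k, l⟩, hc⟩ := c
  rw [pairMatrix_apply, pairOrder] at h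
  obtain ⟨h, σ, hσ⟩ := exists_perm_of_injective ![i, j, k, l] (by
    intro x y
    fin_cases x <;> fin_cases y <;> simp <;> grind)
  refine ⟨σ, ⟨0, by omega⟩, ⟨2, by omega⟩, Or.inl le_rfl, Subtype.ext (Prod.ext ?_ ?_),
    Subtype.ext (Prod.ext ?_ ?_)⟩
  · exact hσ 0
  · exact hσ 1
  · exact hσ 2
  · exact hσ 3

theorem exists_pairAct_of_chain {b c : Pair n} (h : b.1.2 = c.1.1) (h' : b.1.1 ≠ c.1.2) :
    ∃ (σ : Equiv.Perm (Fin n)) (k l : Fin (n - 1)), VBGen.Next k l ∧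
      pairAct n σ (nextPair k) = b ∧ pairAct n σ (nextPair l) = c := by
  obtain ⟨⟨i, j⟩, hb⟩ := b
  obtain ⟨⟨k, l⟩, hc⟩ := c
  obtain ⟨hn, σ, hσ⟩ := exists_perm_of_injective ![i, j, l] (by
    intro x y
    fin_cases x <;> fin_cases y <;> simp <;> grind)
  refine ⟨σ, ⟨0, by omega⟩, ⟨1, by omega⟩, rfl, Subtype.ext (Prod.ext ?_ ?_),
    Subtype.ext (Prod.ext ?_ ?_)⟩
  · exact hσ 0
  · exact hσ 1
  · exact (hσ 1).trans h
  · exact hσ 2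

/-- The conjugate of a generator `s_k` attached to a pair. -/
noncomputable def x (b : Pair n) : FVB n :=
  iota n (exists_pairAct_nextPair b).choose.1 * s (exists_pairAct_nextPair b).choose.2 *
    (iota n (exists_pairAct_nextPair b).choose.1)⁻¹

/-- Independence of the choice in `x`: two choices differ by a permutation carrying neighbours to
neighbours, to which `iota_conj_s` applies. -/
theorem x_pairAct_nextPair (σ : Equiv.Perm (Fin n)) (k : Fin (n - 1)) :
    x (pairAct n σ (nextPair k)) = iota n σ * s k * (iota n σ)⁻¹ := by
  have h := (exists_pairAct_nextPair (pairAct n σ (nextPair k))).choose_spec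
  rw [x]
  generalize (exists_pairAct_nextPair (pairAct n σ (nextPair k))).choose = p at h
  obtain ⟨τ, l⟩ := p
  have h' : pairAct n (τ⁻¹ * σ) (nextPair k) = nextPair l := by
    rw [map_mul, Equiv.Perm.mul_apply, ← h, ← Equiv.Perm.mul_apply, ← map_mul, inv_mul_cancel,
      map_one, Equiv.Perm.one_apply]
  have := iota_conj_s _ (τ⁻¹ * σ) rfl k l (congrArg (fun b => b.1.1) h')
    (congrArg (fun b => b.1.2) h')
  rw [map_mul, map_inv, mul_assoc, inv_mul_eq_iff_eq_mul] at this
  simp only [this, mul_assoc, mul_inv_cancel, mul_one]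

theorem x_nextPair (k : Fin (n - 1)) : x (nextPair k) = s k := by
  simpa using x_pairAct_nextPair 1 k

theorem x_pairAct (σ : Equiv.Perm (Fin n)) (b : Pair n) :
    x (pairAct n σ b) = iota n σ * x b * (iota n σ)⁻¹ := by
  obtain ⟨⟨τ, k⟩, rfl⟩ := exists_pairAct_nextPair b
  rw [← Equiv.Perm.mul_apply, ← map_mul, x_pairAct_nextPair, x_pairAct_nextPair]
  simp [mul_assoc]

theorem x_mul_self (b : Pair n) : x b * x b = 1 := by
  obtain ⟨⟨τ, k⟩, rfl⟩ := exists_pairAct_nextPair b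
  rw [x_pairAct, x_nextPair, conj_mul, s_mul_s, mul_one, mul_inv_cancel]

theorem x_comm {b c : Pair n} (h : pairMatrix n b c = 2) : x b * x c = x c * x b := by
  obtain ⟨σ, k, l, hkl, rfl, rfl⟩ := exists_pairAct_of_two h
  simp only [x_pairAct, x_nextPair, conj_mul, s_comm hkl]

theorem x_braid {b c : Pair n} (h : pairMatrix n b c = 3) : x b * x c * x b = x c * x b * x c := by
  -- Order `3` means that the pairs form a chain in one of two orders, and the braid relation is
  -- symmetric.
  wlog h' : b.1.2 = c.1.1 ∧ b.1.1 ≠ c.1.2 generalizing b c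
  · refine (this ((pairMatrix n).symmetric b c ▸ h) ?_).symm
    rw [pairMatrix_apply, pairOrder] at h
    grind
  obtain ⟨σ, k, l, hkl, rfl, rfl⟩ := exists_pairAct_of_chain h'.1 h'.2
  simp only [x_pairAct, x_nextPair, conj_mul, s_braid hkl]

theorem x_isLiftable (n : ℕ) : (pairMatrix n).IsLiftable (x (n := n)) := by
  intro b c
  have hle := pairMatrix_le_three b c
  obtain h | h | h | h : pairMatrix n b c = 0 ∨ pairMatrix n b c = 1 ∨ pairMatrix n b c = 2 ∨
    pairMatrix n b c = 3 := by omega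
  · rw [h, pow_zero]
  · obtain rfl : b = c := by
      by_contra h'
      exact (pairMatrix n).off_diagonal b c h' h
    rw [h, pow_one, x_mul_self]
  · rw [h, pow_two]
    nth_rw 2 [x_comm h]
    rw [mul_assoc, ← mul_assoc (x c), x_mul_self, one_mul, x_mul_self]
  · rw [h]
    calc (x b * x c) ^ 3 = (x b * x c * x b) * (x c * x b * x c) := by
          simp only [pow_succ, pow_zero, one_mul, mul_assoc]
      _ = (x c * x b * x c) * (x c * x b * x c) := by rw [x_braid h]
      _ = x c * (x b * (x c * x c) * x b) * x c := by simp only [mul_assoc]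
      _ = 1 := by simp [x_mul_self]

/-- The homomorphism from the Coxeter group of the pairs to `FVB_n`. -/
noncomputable def pairHom (n : ℕ) : (pairMatrix n).Group →* FVB n :=
  (pairMatrix n).toCoxeterSystem.lift ⟨x, x_isLiftable n⟩

@[simp]
theorem pairHom_simple (b : Pair n) : pairHom n ((pairMatrix n).simple b) = x b :=
  CoxeterSystem.lift_apply_simple _ _ b

/-- The homomorphism from the semidirect product to `FVB_n`. -/
noncomputable def ofSemi (n : ℕ) : (pairMatrix n).Group ⋊[pairAut n] Equiv.Perm (Fin n) →* FVB n :=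
  SemidirectProduct.lift (pairHom n) (iota n) fun σ =>
    (pairMatrix n).toCoxeterSystem.ext_simple fun b => by simp [x_pairAct]

/-- The values on the generators of the homomorphism from `FVB_n` to the semidirect product. -/
def toSemiGen : VBGen n → (pairMatrix n).Group ⋊[pairAut n] Equiv.Perm (Fin n)
  | VBGen.sigma i => SemidirectProduct.inl ((pairMatrix n).simple (nextPair i))
  | VBGen.rho i => SemidirectProduct.inr (adjSwap i)

theorem pairAct_adjSwap_of_far {i j : Fin (n - 1)} (h : VBGen.Far i j) :
    pairAct n (adjSwap j) (nextPair i) = nextPair i := by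
  unfold VBGen.Far at h
  refine Subtype.ext (Prod.ext ?_ ?_)
  · exact adjSwap_of_ne (by simp only [nextPair, lo]; omega) (by simp only [nextPair, lo]; omega)
  · exact adjSwap_of_ne (by simp only [nextPair, hi]; omega) (by simp only [nextPair, hi]; omega)

theorem pairAct_adjSwap_of_next {i j : Fin (n - 1)} (h : VBGen.Next i j) :
    pairAct n (adjSwap i * adjSwap j) (nextPair i) = nextPair j := by
  unfold VBGen.Next at h
  have e : lo j = hi i := Fin.ext h
  have e1 : adjSwap j (lo i) = lo i :=
    adjSwap_of_ne (by simp only [lo]; omega) (by simp only [lo]; omega)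
  have e2 : adjSwap i (hi j) = hi j :=
    adjSwap_of_ne (by simp only [hi]; omega) (by simp only [hi]; omega)
  refine Subtype.ext (Prod.ext ?_ ?_)
  · change adjSwap i (adjSwap j (lo i)) = lo j
    rw [e1, adjSwap_lo, e]
  · change adjSwap i (adjSwap j (hi i)) = hi j
    rw [← e, adjSwap_lo, e2]

theorem toSemiGen_rels :
    ∀ w ∈ flatVirtualBraidRels n, FreeGroup.lift (toSemiGen (n := n)) w = 1 := by
  have conj : ∀ (σ : Equiv.Perm (Fin n)) (b : Pair n),
      (SemidirectProduct.inr σ * SemidirectProduct.inl ((pairMatrix n).simple b) :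
        (pairMatrix n).Group ⋊[pairAut n] Equiv.Perm (Fin n)) =
      SemidirectProduct.inl ((pairMatrix n).simple (pairAct n σ b)) * SemidirectProduct.inr σ := by
    intro σ b
    rw [← pairAut_simple, SemidirectProduct.inl_aut, map_inv, inv_mul_cancel_right]
  rintro w (hw | ⟨i, rfl⟩)
  · cases hw with
    | sigma_braid i j h =>
      rw [map_mul, map_inv, mul_inv_eq_one]
      simp only [VBGen.s, map_mul, FreeGroup.lift_apply_of, toSemiGen]
      rw [← map_mul, ← map_mul, ← map_mul, ← map_mul]
      refine congrArg _ ((pairMatrix n).toCoxeterSystem.simple_braid_of_three ?_)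
      unfold VBGen.Next at h
      simp only [pairMatrix_apply, pairOrder, nextPair, lo, hi, Subtype.ext_iff, Prod.ext_iff,
        Fin.ext_iff]
      grind
    | sigma_comm i j h =>
      rw [map_mul, map_inv, mul_inv_eq_one]
      simp only [VBGen.s, map_mul, FreeGroup.lift_apply_of, toSemiGen]
      rw [← map_mul, ← map_mul]
      refine congrArg _ ((pairMatrix n).toCoxeterSystem.simple_comm_of_two ?_)
      unfold VBGen.Far at h
      simp only [pairMatrix_apply, pairOrder, nextPair, lo, hi, Subtype.ext_iff, Prod.ext_iff,
        Fin.ext_iff]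
      grind
    | rho_braid i j h =>
      rw [map_mul, map_inv, mul_inv_eq_one]
      simp only [VBGen.r, map_mul, FreeGroup.lift_apply_of, toSemiGen]
      simp only [← map_mul, adjSwap_braid i j h]
    | rho_comm i j h =>
      rw [map_mul, map_inv, mul_inv_eq_one]
      simp only [VBGen.r, map_mul, FreeGroup.lift_apply_of, toSemiGen]
      simp only [← map_mul, adjSwap_comm i j h]
    | rho_sq i =>
      simp only [VBGen.r, map_pow, FreeGroup.lift_apply_of, toSemiGen]
      rw [← map_pow, pow_two, adjSwap_mul_self, map_one]
    | mixed_comm i j h =>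
      rw [map_mul, map_inv, mul_inv_eq_one]
      simp only [VBGen.s, VBGen.r, map_mul, FreeGroup.lift_apply_of, toSemiGen]
      rw [conj, pairAct_adjSwap_of_far h]
    | mixed_braid i j h =>
      rw [map_mul, map_inv, mul_inv_eq_one]
      simp only [VBGen.s, VBGen.r, map_mul, FreeGroup.lift_apply_of, toSemiGen]
      rw [← map_mul, conj, pairAct_adjSwap_of_next h, map_mul, mul_assoc]
  · simp only [VBGen.s, map_pow, FreeGroup.lift_apply_of, toSemiGen]
    rw [← map_pow]
    exact (congrArg _ ((pairMatrix n).toCoxeterSystem.simple_sq (nextPair i))).trans (map_one _)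

/-- The homomorphism from `FVB_n` to the semidirect product. -/
def toSemi (n : ℕ) : FVB n →* (pairMatrix n).Group ⋊[pairAut n] Equiv.Perm (Fin n) :=
  PresentedGroup.toGroup toSemiGen_rels

@[simp]
theorem toSemi_s (i : Fin (n - 1)) :
    toSemi n (s i) = SemidirectProduct.inl ((pairMatrix n).simple (nextPair i)) :=
  PresentedGroup.toGroup.of toSemiGen_rels

@[simp]
theorem toSemi_r (i : Fin (n - 1)) : toSemi n (r i) = SemidirectProduct.inr (adjSwap i) :=
  PresentedGroup.toGroup.of toSemiGen_rels

@[simp]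
theorem toSemi_iota (σ : Equiv.Perm (Fin n)) : toSemi n (iota n σ) = SemidirectProduct.inr σ := by
  have : (toSemi n).comp (iota n) = SemidirectProduct.inr := perm_hom_ext (by simp)
  exact DFunLike.congr_fun this σ

theorem toSemi_x (b : Pair n) :
    toSemi n (x b) = SemidirectProduct.inl ((pairMatrix n).simple b) := by
  obtain ⟨⟨τ, k⟩, rfl⟩ := exists_pairAct_nextPair b
  rw [x_pairAct, x_nextPair, ← pairAut_simple, SemidirectProduct.inl_aut]
  simp

/-- `FVB_n` is the semidirect product of the Coxeter group of the pairs and of `S_n`. -/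
noncomputable def semiEquiv (n : ℕ) :
    FVB n ≃* (pairMatrix n).Group ⋊[pairAut n] Equiv.Perm (Fin n) :=
  MonoidHom.toMulEquiv (toSemi n) (ofSemi n)
    (PresentedGroup.ext fun g => by
      cases g with
      | sigma i => exact (congrArg (ofSemi n) (toSemi_s i)).trans (by simp [ofSemi, x_nextPair]; rfl)
      | rho i => exact (congrArg (ofSemi n) (toSemi_r i)).trans (by simp [ofSemi]; rfl))
    (SemidirectProduct.hom_ext
      ((pairMatrix n).toCoxeterSystem.ext_simple fun b => by simp [ofSemi, toSemi_x])
      (MonoidHom.ext fun σ => by simp [ofSemi]))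

theorem mu_eq_right (g : FVB n) : mu n g = (semiEquiv n g).right := by
  have : mu n = SemidirectProduct.rightHom.comp (semiEquiv n).toMonoidHom :=
    PresentedGroup.ext fun g => by
      cases g with
      | sigma i =>
        exact (mu_s i).trans (congrArg SemidirectProduct.right (toSemi_s i)).symm
      | rho i =>
        exact (mu_r i).trans (congrArg SemidirectProduct.right (toSemi_r i)).symm
  exact DFunLike.congr_fun this g

/-- The Coxeter system of `FH_n`. -/
noncomputable def pairSystem (n : ℕ) : CoxeterSystem (pairMatrix n) (FH n) where
  mulEquiv :=
    { toFun := fun h => (semiEquiv n h).left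
      invFun := fun w => ⟨(semiEquiv n).symm (SemidirectProduct.inl w), by
        rw [MonoidHom.mem_ker, mu_eq_right, MulEquiv.apply_symm_apply,
          SemidirectProduct.right_inl]⟩
      left_inv := fun h => by
        have : (semiEquiv n h).right = 1 := by rw [← mu_eq_right]; exact h.2
        refine Subtype.ext ?_
        rw [MulEquiv.symm_apply_eq]
        exact SemidirectProduct.ext rfl this.symm
      right_inv := fun w => by simp
      -- On the kernel the right component is `1`, so the twist in the product disappears.
      map_mul' := fun h k => by
        have : (semiEquiv n h).right = 1 := by rw [← mu_eq_right]; exact h.2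
        simp [this] }

end FVB

/-! ### Linearity -/

theorem isLinearGroup_of_injective {G U : Type} [Group G] [AddCommGroup U] [Module ℚ U]
    [FiniteDimensional ℚ U] (ρ : G →* Module.End ℚ U) (hρ : Function.Injective ρ) :
    IsLinearGroup G := by
  let T : Module.End ℚ U ≃ₐ[ℚ] Matrix (Fin (Module.finrank ℚ U)) (Fin (Module.finrank ℚ U)) ℚ :=
    LinearMap.toMatrixAlgEquiv (Module.finBasis ℚ U)
  refine ⟨ℚ, inferInstance, Module.finrank ℚ U,
    ((T : Module.End ℚ U →* _).comp ρ).toHomUnits, fun g h hgh => hρ (T.injective ?_)⟩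
  exact congrArg Units.val hgh

namespace FVB

variable {n : ℕ}

/-- Invariance of the Cartan integers under `S_n` gives the compatibility needed to extend the
geometric representation to the semidirect product. -/
theorem coordRep_mul_titsReflection (σ : Equiv.Perm (Fin n)) (b : Pair n) :
    coordRep (Pair n) (pairAct n σ) * (pairMatrix n).titsReflection b =
      (pairMatrix n).titsReflection (pairAct n σ b) * coordRep (Pair n) (pairAct n σ) := by
  refine LinearMap.pi_ext' fun c => LinearMap.ext_ring ?_
  simp [CoxeterMatrix.titsReflection_single, pairMatrix_pairAct]

/-- The geometric representation of the Coxeter group of the pairs, extended by the permutations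
of the simple roots. -/
noncomputable def semiRep (n : ℕ) :
    (pairMatrix n).Group ⋊[pairAut n] Equiv.Perm (Fin n) →* Module.End ℚ (Pair n → ℚ) :=
  (Units.coeHom _).comp (SemidirectProduct.lift
    (CoxeterMatrix.titsRep (pairMatrix n).toCoxeterSystem pairMatrix_le_three).toHomUnits
    ((coordRep (Pair n)).comp (pairAct n)).toHomUnits fun σ =>
      (pairMatrix n).toCoxeterSystem.ext_simple fun b => by
        rw [MonoidHom.comp_apply, MonoidHom.comp_apply, MulEquiv.coe_toMonoidHom,
          MulEquiv.coe_toMonoidHom, MulAut.conj_apply, eq_mul_inv_iff_mul_eq]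
        refine Units.ext ?_
        have e := fun c => CoxeterMatrix.titsRep_simple (pairMatrix n).toCoxeterSystem
          pairMatrix_le_three c
        simp only [CoxeterMatrix.toCoxeterSystem_simple] at e
        simpa [e] using (coordRep_mul_titsReflection σ b).symm)

theorem isLinearGroup (n : ℕ) : IsLinearGroup (FVB n) := by
  let θ : (pairMatrix n).Group ⋊[pairAut n] Equiv.Perm (Fin n) →*
      Module.End ℚ ((Pair n → ℚ) × (Fin n → ℚ)) :=
    -- In this direct sum the second summand detects the permutation; once that is trivial, the
    -- first is the faithful geometric representation.
    (LinearMap.prodMapRingHom ℚ (Pair n → ℚ) (Fin n → ℚ) : _ →* _).comp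
      ((semiRep n).prod ((coordRep (Fin n)).comp SemidirectProduct.rightHom))
  have hθ : Function.Injective θ := by
    rw [injective_iff_map_eq_one]
    intro g hg
    have h1 : coordRep (Fin n) g.right = 1 := LinearMap.ext fun v =>
      congrArg Prod.snd (LinearMap.congr_fun hg (0, v))
    have h2 : semiRep n g = 1 := LinearMap.ext fun v =>
      congrArg Prod.fst (LinearMap.congr_fun hg (v, 0))
    have hr : g.right = 1 := coordRep_injective _ (h1.trans (map_one _).symm)
    obtain ⟨w, σ⟩ := g
    obtain rfl : σ = 1 := hr
    have h3 : CoxeterMatrix.titsRep (pairMatrix n).toCoxeterSystem pairMatrix_le_three w = 1 := by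
      simpa [semiRep, SemidirectProduct.lift] using h2
    have hw : w = 1 := CoxeterMatrix.titsRep_injective _ _ (h3.trans (map_one _).symm)
    rw [hw]
    rfl
  exact isLinearGroup_of_injective (θ.comp (semiEquiv n).toMonoidHom)
    (hθ.comp (semiEquiv n).injective)

end FVB

theorem mainTheorem9 (n : ℕ) :
    -- `FVB_n` is the semidirect product of its normal subgroup `FH_n` and of `S_n`,
    -- embedded by `(i, i + 1) ↦ ρ_i`
    (∃ (φ : Equiv.Perm (Fin n) →* MulAut (FH n)) (e : FH n ⋊[φ] Equiv.Perm (Fin n) ≃* FVB n),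
      (∀ h : FH n, e (SemidirectProduct.inl h) = (h : FVB n)) ∧
      (∀ i : Fin (n - 1), e (SemidirectProduct.inr (FVB.adjSwap i)) = FVB.r i) ∧
      (∀ x : FH n ⋊[φ] Equiv.Perm (Fin n), FVB.mu n (e x) = x.right)) ∧
    -- `FH_n` is a finitely generated Coxeter group
    (∃ (B : Type) (_ : Finite B) (M : CoxeterMatrix B), Nonempty (CoxeterSystem M (FH n))) ∧
    -- `FVB_n` is linear
    IsLinearGroup (FVB n) := by
  obtain ⟨φ, e, h1, h2, h3⟩ :=
    SemidirectProduct.exists_mulEquiv_of_section (FVB.mu n) (FVB.iota n) FVB.mu_iota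
  exact ⟨⟨φ, e, h1, fun i => (h2 _).trans (FVB.iota_adjSwap i), h3⟩,
    ⟨FVB.Pair n, inferInstance, FVB.pairMatrix n, ⟨FVB.pairSystem n⟩⟩, FVB.isLinearGroup n⟩
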